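/- Let $(X,\mathscr A,\mu)$ be a $\sigma$-finite measure space, $\phi\colon X\to X$ an $\mathscr A$-measurable map and $w\colon X\to\mathbb C$ an $\mathscr A$-measurable function; put $\mu_w(\sigma)=\int_\sigma|w|^2\,d\mu$ for $\sigma\in\mathscr A$. Assume that $\mu\circ\phi^{-1}$ and $\mu_w\circ\phi^{-1}$ are absolutely continuous with respect to $\mu$. Let $C_{\phi,w}$ be the weighted composition operator in the complex Hilbert space $L^2(\mu)$ given by $C_{\phi,w}f=w\cdot(f\circ\phi)$ with domain $\{f\in L^2(\mu): w\cdot(f\circ\phi)\in L^2(\mu)\}$, and let $C_\phi=C_{\phi,\mathbf 1}$. Let $\mathsf h_\phi=\frac{d(\mu\circ\phi^{-1})}{d\mu}\colon X\to[0,\infty]$ be the Radon--Nikodym derivative, and let $\mathsf E_\phi(|w|^2)$ be the conditional expectation of $|w|^2\colon X\to[0,\infty)$ with respect to the $\sigma$-algebra $\phi^{-1}(\mathscr A)$ and the measure $\mu$. For a closed operator $T$ in a Hilbert space, with kernel $\mathcal N(T)$, domain $\mathcal D(T)$ and range $\mathcal R(T)$, let $T^\dag$ denote its reciprocal, i.e.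 the unique operator with domain $\mathcal R(T)\oplus\mathcal R(T)^\perp$ and kernel $\mathcal R(T)^\perp$ such that $TT^\dag f=P_{\overline{\mathcal R(T)}}f$ for $f\in\mathcal D(T^\dag)$ and $T^\dag Tg=P_{\mathcal N(T)^\perp}g$ for $g\in\mathcal D(T)$, where $P_M$ is the orthogonal projection onto $M$. If both $C_\phi$ and $C_{\phi,w}$ are densely defined in $L^2(\mu)$, then $$\mathcal D\big((C_{\phi,w}^*)^\dag\big)=\Big\{f\in L^2(\mu):\ \frac{w\,(f\circ\phi)}{(\mathsf h_\phi\circ\phi)\,\mathsf E_\phi(|w|^2)}\in L^2(\mu)\Big\},$$ and $$(C_{\phi,w}^*)^\dag f=\frac{w\,(f\circ\phi)}{(\mathsf h_\phi\circ\phi)\,\mathsf E_\phi(|w|^2)}\quad\mu\text{-a.e.},\qquad f\in\mathcal D\big((C_{\phi,w}^*)^\dag\big),$$ where the quotient is taken to be $0$ wherever $w=0$. -/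

import Mathlib

open MeasureTheory
open scoped ENNReal

noncomputable section

/-! ### The reciprocal (maximal Tseng inverse) of an operator between Hilbert spaces -/

section Reciprocal

variable {𝕜 E F : Type*} [RCLike 𝕜]
  [NormedAddCommGroup E] [InnerProductSpace 𝕜 E]
  [NormedAddCommGroup F] [InnerProductSpace 𝕜 F]

/-- The kernel of `T`, as a subspace of the ambient space. -/
def pmapKer (T : E →ₗ.[𝕜] F) : Submodule 𝕜 E :=
  (LinearMap.ker T.toFun).map T.domain.subtype

/-- The range of `T`. -/
def pmapRange (T : E →ₗ.[𝕜] F) : Submodule 𝕜 F :=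
  LinearMap.range T.toFun

/-- The condition `D(T) = N(T) ⊕ (D(T) ∩ N(T)ᗮ)` under which the reciprocal exists
(the sum is automatically orthogonal). -/
def KerDecomposition (T : E →ₗ.[𝕜] F) : Prop :=
  T.domain = pmapKer T ⊔ (T.domain ⊓ (pmapKer T)ᗮ)

/-- The defining properties of the reciprocal `S` of `T`: its domain is `R(T) ⊕ R(T)ᗮ`,
`T S f` is the projection of `f` on the closure of `R(T)`, `S T g` is the projection of `g` on
`N(T)ᗮ`, and `N(S) = R(T)ᗮ`. -/
structure IsReciprocal [CompleteSpace E] [CompleteSpace F]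
    (T : E →ₗ.[𝕜] F) (S : F →ₗ.[𝕜] E) : Prop where
  domain_eq : S.domain = pmapRange T ⊔ (pmapRange T)ᗮ
  apply_left : ∀ f : S.domain, ∃ h : S f ∈ T.domain,
    T ⟨S f, h⟩ = (pmapRange T).topologicalClosure.starProjection (f : F)
  apply_right : ∀ g : T.domain, ∃ h : T g ∈ S.domain,
    S ⟨T g, h⟩ = (pmapKer T)ᗮ.starProjection (g : E)
  ker_eq : pmapKer S = (pmapRange T)ᗮ

/-- The graph of the reciprocal of `T`: pairs `(f, g)` with `g ∈ D(T) ∩ N(T)ᗮ` and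
`f - T g ∈ R(T)ᗮ`. -/
def reciprocalGraph (T : E →ₗ.[𝕜] F) : Submodule 𝕜 (F × E) where
  carrier := {p | ∃ g : T.domain, (g : E) = p.2 ∧ (g : E) ∈ (pmapKer T)ᗮ ∧
    p.1 - T g ∈ (pmapRange T)ᗮ}
  zero_mem' := ⟨0, by simp⟩
  add_mem' := by
    rintro ⟨f, _⟩ ⟨f', _⟩ ⟨g, rfl, h1, h2⟩ ⟨g', rfl, h1', h2'⟩
    refine ⟨g + g', rfl, add_mem h1 h1', ?_⟩
    have := add_mem h2 h2'
    rw [LinearPMap.map_add]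
    convert this using 1
    simp only [Prod.mk_add_mk]
    abel
  smul_mem' := by
    rintro c ⟨f, _⟩ ⟨g, rfl, h1, h2⟩
    refine ⟨c • g, rfl, Submodule.smul_mem _ c h1, ?_⟩
    have := Submodule.smul_mem _ c h2
    rw [LinearPMap.map_smul]
    convert this using 1
    simp [smul_sub]

/-- The reciprocal of `T`. -/
def reciprocal (T : E →ₗ.[𝕜] F) : F →ₗ.[𝕜] E :=
  (reciprocalGraph T).toLinearPMap

theorem mem_pmapKer {T : E →ₗ.[𝕜] F} {x : E} :
    x ∈ pmapKer T ↔ ∃ g : T.domain, T g = 0 ∧ (g : E) = x := by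
  simp only [pmapKer, Submodule.mem_map, LinearMap.mem_ker]
  rfl

theorem mem_pmapRange {T : E →ₗ.[𝕜] F} {y : F} :
    y ∈ pmapRange T ↔ ∃ g : T.domain, T g = y := Iff.rfl

/-- The graph above is the graph of a function. -/
theorem reciprocalGraph_single_valued (T : E →ₗ.[𝕜] F) :
    ∀ p ∈ reciprocalGraph T, p.1 = 0 → p.2 = 0 := by
  rintro ⟨f, _⟩ ⟨g, rfl, h1, h2⟩ hf
  simp only at hf h2 ⊢
  subst hf
  rw [zero_sub, Submodule.neg_mem_iff] at h2
  have h3 : T g = 0 := by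
    have := (Submodule.mem_orthogonal _ _).1 h2 (T g) (mem_pmapRange.2 ⟨g, rfl⟩)
    exact inner_self_eq_zero.1 this
  have := (Submodule.mem_orthogonal _ _).1 h1 (g : E) (mem_pmapKer.2 ⟨g, h3, rfl⟩)
  exact inner_self_eq_zero.1 this

theorem graph_reciprocal (T : E →ₗ.[𝕜] F) : (reciprocal T).graph = reciprocalGraph T :=
  Submodule.toLinearPMap_graph_eq _ (reciprocalGraph_single_valued T)

/-- Closed operators satisfy the decomposition condition. -/
theorem kerDecomposition_of_isClosed [CompleteSpace E] {T : E →ₗ.[𝕜] F} (hT : T.IsClosed) :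
    KerDecomposition T := by
  have hcl : IsClosed (pmapKer T : Set E) := by
    have : (pmapKer T : Set E) = (fun x : E => (x, (0 : F))) ⁻¹' (T.graph : Set (E × F)) := by
      ext x
      simp only [SetLike.mem_coe, mem_pmapKer, Set.mem_preimage, LinearPMap.mem_graph_iff]
      exact ⟨fun ⟨g, h, h'⟩ => ⟨g, h', h⟩, fun ⟨g, h, h'⟩ => ⟨g, h', h⟩⟩
    rw [this]
    exact hT.preimage (by fun_prop)
  have : CompleteSpace (pmapKer T) := hcl.completeSpace_coe
  have hle : pmapKer T ≤ T.domain := fun x hx => by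
    obtain ⟨g, -, rfl⟩ := mem_pmapKer.1 hx
    exact g.2
  refine le_antisymm (fun x hx => ?_) (sup_le hle inf_le_left)
  have h1 : (pmapKer T).starProjection x ∈ pmapKer T := Submodule.starProjection_apply_mem _ x
  refine Submodule.mem_sup.2 ⟨_, h1, x - (pmapKer T).starProjection x,
    ⟨sub_mem hx (hle h1), ?_⟩, by abel⟩
  exact Submodule.sub_starProjection_mem_orthogonal x

/-- Under the decomposition condition, `reciprocal T` has the defining properties. -/
theorem isReciprocal_reciprocal [CompleteSpace E] [CompleteSpace F] {T : E →ₗ.[𝕜] F}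
    (hT : KerDecomposition T) : IsReciprocal T (reciprocal T) := by
  have key : ∀ g : T.domain, ∃ g' : T.domain, (g' : E) ∈ (pmapKer T)ᗮ ∧ T g' = T g ∧
      (g : E) - g' ∈ pmapKer T := by
    intro g
    have hg : (g : E) ∈ pmapKer T ⊔ (T.domain ⊓ (pmapKer T)ᗮ) := hT ▸ g.2
    obtain ⟨a, ha, b, hb, hab⟩ := Submodule.mem_sup.1 hg
    have ha0 := ha
    obtain ⟨a', ha', rfl⟩ := mem_pmapKer.1 ha
    refine ⟨⟨b, hb.1⟩, hb.2, ?_, ?_⟩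
    · have : g = a' + ⟨b, hb.1⟩ := Subtype.ext hab.symm
      rw [this, LinearPMap.map_add, ha', zero_add]
    · rw [← hab]
      simpa using ha0
  have hmem : ∀ {f : F} {g : E}, (f, g) ∈ (reciprocal T).graph ↔ ∃ g' : T.domain,
      (g' : E) = g ∧ (g' : E) ∈ (pmapKer T)ᗮ ∧ f - T g' ∈ (pmapRange T)ᗮ := by
    intro f g
    rw [graph_reciprocal]
    rfl
  refine ⟨?_, ?_, ?_, ?_⟩
  · ext f
    rw [LinearPMap.mem_domain_iff, Submodule.mem_sup]
    constructor
    · rintro ⟨g, hg⟩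
      obtain ⟨g', -, -, h⟩ := hmem.1 hg
      exact ⟨T g', mem_pmapRange.2 ⟨g', rfl⟩, _, h, by abel⟩
    · rintro ⟨y, hy, z, hz, rfl⟩
      obtain ⟨g, rfl⟩ := mem_pmapRange.1 hy
      obtain ⟨g', h1, h2, -⟩ := key g
      exact ⟨g', hmem.2 ⟨g', rfl, h1, by simpa [h2] using hz⟩⟩
  · intro f
    obtain ⟨g', h0, h1, h2⟩ := hmem.1 ((reciprocal T).mem_graph f)
    refine ⟨h0 ▸ g'.2, ?_⟩
    have : (⟨reciprocal T f, h0 ▸ g'.2⟩ : T.domain) = g' := Subtype.ext h0.symm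
    rw [this]
    refine (Submodule.eq_starProjection_of_mem_orthogonal ?_ ?_).symm
    · exact Submodule.le_topologicalClosure _ (mem_pmapRange.2 ⟨g', rfl⟩)
    · rwa [Submodule.orthogonal_closure]
  · intro g
    obtain ⟨g', h1, h2, h3⟩ := key g
    have hgr : (T g, (g' : E)) ∈ (reciprocal T).graph := hmem.2 ⟨g', rfl, h1, by simp [h2]⟩
    refine ⟨LinearPMap.mem_domain_of_mem_graph hgr, ?_⟩
    rw [← (LinearPMap.image_iff (LinearPMap.mem_domain_of_mem_graph hgr)).2 hgr]
    refine (Submodule.eq_starProjection_of_mem_orthogonal h1 ?_).symm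
    exact Submodule.le_orthogonal_orthogonal _ h3
  · ext f
    rw [mem_pmapKer]
    constructor
    · rintro ⟨f, hf, rfl⟩
      obtain ⟨g', h0, -, h2⟩ := hmem.1 ((reciprocal T).mem_graph f)
      have : g' = 0 := Subtype.ext (h0.trans hf)
      simpa [this] using h2
    · intro hf
      have hgr : (f, (0 : E)) ∈ (reciprocal T).graph := hmem.2 ⟨0, rfl, by simp, by simpa using hf⟩
      obtain ⟨f', h1, h2⟩ := (LinearPMap.mem_graph_iff _).1 hgr
      exact ⟨f', h2, h1⟩

/-- The reciprocal is uniquely determined by its defining properties. -/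
theorem IsReciprocal.unique [CompleteSpace E] [CompleteSpace F] {T : E →ₗ.[𝕜] F}
    {S S' : F →ₗ.[𝕜] E} (h : IsReciprocal T S) (h' : IsReciprocal T S') : S = S' := by
  refine LinearPMap.ext (h.domain_eq.trans h'.domain_eq.symm) fun x hx hx' => ?_
  have hx2 : x ∈ pmapRange T ⊔ (pmapRange T)ᗮ := h.domain_eq ▸ hx
  obtain ⟨y, hy, z, hz, rfl⟩ := Submodule.mem_sup.1 hx2
  obtain ⟨g, rfl⟩ := mem_pmapRange.1 hy
  obtain ⟨m, e⟩ := h.apply_right g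
  obtain ⟨m', e'⟩ := h'.apply_right g
  obtain ⟨k, hk, hkz⟩ := mem_pmapKer.1 (h.ker_eq.symm ▸ hz)
  obtain ⟨k', hk', hkz'⟩ := mem_pmapKer.1 (h'.ker_eq.symm ▸ hz)
  have e1 : (⟨T g + z, hx⟩ : S.domain) = ⟨T g, m⟩ + k := Subtype.ext (by simp [hkz])
  have e2 : (⟨T g + z, hx'⟩ : S'.domain) = ⟨T g, m'⟩ + k' := Subtype.ext (by simp [hkz'])
  rw [e1, e2, LinearPMap.map_add, LinearPMap.map_add, hk, hk', e, e']

/-- In particular, the adjoint of a densely defined operator has a reciprocal. -/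
theorem isReciprocal_reciprocal_adjoint [CompleteSpace E] [CompleteSpace F] {T : E →ₗ.[𝕜] F}
    (hT : Dense (T.domain : Set E)) : IsReciprocal T.adjoint (reciprocal T.adjoint) :=
  isReciprocal_reciprocal (kerDecomposition_of_isClosed (LinearPMap.adjoint_isClosed hT))

end Reciprocal

/-! ### Weighted composition operators -/

section WeightedComposition

variable {X : Type*} [MeasurableSpace X]

/-- The measure `μ_w(σ) = ∫_σ |w|² dμ`. -/
def weightMeasure (μ : Measure X) (w : X → ℂ) : Measure X :=
  μ.withDensity fun x => ‖w x‖ₑ ^ 2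

/-- The measure `μ_w ∘ φ⁻¹`. -/
def weightImage (μ : Measure X) (φ : X → X) (w : X → ℂ) : Measure X :=
  (weightMeasure μ w).map φ

/-- The Radon-Nikodym derivative `h_{φ,w}` of `μ_w ∘ φ⁻¹` with respect to `μ`. -/
def hDeriv (μ : Measure X) (φ : X → X) (w : X → ℂ) : X → ℝ≥0∞ :=
  (weightImage μ φ w).rnDeriv μ

/-- The conditional expectation `E_{φ,w}(f)` of `f : X → [0,∞]` with respect to the σ-algebra
`φ⁻¹(𝒜)` and the measure `μ_w`. -/
def wcondExp (μ : Measure X) (φ : X → X) (w : X → ℂ) (f : X → ℝ≥0∞) : X → ℝ≥0∞ :=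
  condLExp (MeasurableSpace.comap φ inferInstance) (weightMeasure μ w) f

/-- If `μ_w ∘ φ⁻¹ ≪ μ`, then a `μ`-a.e. property holds at `φ x` for `μ`-almost every `x` with
`w x ≠ 0`. -/
theorem ae_comp_of_weight_ne_zero {μ : Measure X} {φ : X → X} {w : X → ℂ}
    (hφ : Measurable φ) (hw : Measurable w) (hac : weightImage μ φ w ≪ μ)
    {p : X → Prop} (hp : ∀ᵐ x ∂μ, p x) : ∀ᵐ x ∂μ, w x ≠ 0 → p (φ x) := by
  have h1 : ∀ᵐ x ∂(weightMeasure μ w), p (φ x) :=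
    ae_of_ae_map hφ.aemeasurable (hac.ae_le hp)
  rw [weightMeasure, ae_withDensity_iff (by fun_prop)] at h1
  filter_upwards [h1] with x hx hwx
  exact hx (by simpa using hwx)

/-- The weighted composition operator `C_{φ,w} f = w · (f ∘ φ)` in `L²(μ)`, with domain
`{f ∈ L²(μ) : w · (f ∘ φ) ∈ L²(μ)}`. The composition operator is `C_φ = C_{φ,1}`. -/
def wcompOp (μ : Measure X) {φ : X → X} {w : X → ℂ}
    (hφ : Measurable φ) (hw : Measurable w) (hac : weightImage μ φ w ≪ μ) :
    Lp ℂ 2 μ →ₗ.[ℂ] Lp ℂ 2 μ where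
  domain :=
    { carrier := {f | MemLp (fun x => w x * f (φ x)) 2 μ}
      zero_mem' := by
        refine (MemLp.zero' (μ := μ) (p := 2) (ε := ℂ)).ae_eq ?_
        filter_upwards [ae_comp_of_weight_ne_zero hφ hw hac (Lp.coeFn_zero ℂ 2 μ)] with x hx
        by_cases h : w x = 0
        · simp [h]
        · rw [hx h, Pi.zero_apply, mul_zero]
      add_mem' := by
        intro f g hf hg
        refine (MemLp.add hf hg).ae_eq ?_
        filter_upwards [ae_comp_of_weight_ne_zero hφ hw hac (Lp.coeFn_add f g)] with x hx
        by_cases h : w x = 0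
        · simp [h]
        · change w x * f (φ x) + w x * g (φ x) = w x * (f + g : Lp ℂ 2 μ) (φ x)
          rw [hx h, Pi.add_apply, mul_add]
      smul_mem' := by
        intro c f hf
        refine (MemLp.const_smul hf c).ae_eq ?_
        filter_upwards [ae_comp_of_weight_ne_zero hφ hw hac (Lp.coeFn_smul c f)] with x hx
        by_cases h : w x = 0
        · simp [h]
        · simp [hx h, mul_left_comm] }
  toFun :=
    { toFun := fun f => MemLp.toLp (fun x => w x * (f : Lp ℂ 2 μ) (φ x)) f.2
      map_add' := by
        intro f g
        rw [← MemLp.toLp_add]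
        refine MemLp.toLp_congr _ _ ?_
        filter_upwards [ae_comp_of_weight_ne_zero hφ hw hac
          (Lp.coeFn_add (f : Lp ℂ 2 μ) (g : Lp ℂ 2 μ))] with x hx
        by_cases h : w x = 0
        · simp [h]
        · change w x * (f + g : Lp ℂ 2 μ) (φ x) =
            w x * (f : Lp ℂ 2 μ) (φ x) + w x * (g : Lp ℂ 2 μ) (φ x)
          rw [hx h, Pi.add_apply, mul_add]
      map_smul' := by
        intro c f
        rw [RingHom.id_apply, ← MemLp.toLp_const_smul]
        refine MemLp.toLp_congr _ _ ?_
        filter_upwards [ae_comp_of_weight_ne_zero hφ hw hac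
          (Lp.coeFn_smul c (f : Lp ℂ 2 μ))] with x hx
        by_cases h : w x = 0
        · simp [h]
        · simp [hx h, mul_left_comm] }

/-- `h_{φ,w}` is a density of `μ_w ∘ φ⁻¹` with respect to `μ`. -/
theorem lintegral_hDeriv {μ : Measure X} [SigmaFinite μ] {φ : X → X} {w : X → ℂ}
    (hφ : Measurable φ) (hac : weightImage μ φ w ≪ μ) {s : Set X} (hs : MeasurableSet s) :
    ∫⁻ x in s, hDeriv μ φ w x ∂μ = weightMeasure μ w (φ ⁻¹' s) := by
  have : SFinite (weightImage μ φ w) := by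
    unfold weightImage weightMeasure
    infer_instance
  rw [← Measure.map_apply hφ hs]
  exact Measure.setLIntegral_rnDeriv hac s

end WeightedComposition

end

/-! ### Change of variables along `φ` and the densities `h_{φ,w}`. -/

section Density

variable {X : Type*} [MeasurableSpace X] {μ : Measure X} {φ : X → X} {w : X → ℂ}

/-! Write T for `C_{φ,w}` and h for `h_{φ,w}`. Since h is the density of `μ_w ∘ φ⁻¹`, the integral
of |w|² (F ∘ φ) equals that of h F. Hence T* sends w (k ∘ φ) to h k whenever both are in L²
(`adjoint_wcompOp_apply`, `adjoint_wcompOp_coeFn`). The space N(T*)ᗮ is the closure of R(T), and it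
consists of the L² functions w (k ∘ φ) with k measurable but not necessarily in L²
(`exists_eq_weight_mul_comp_of_mem_closure`, `mem_orthogonal_ker_adjoint`). Inverting T* therefore
means solving h k = f on {h ≠ 0}; on {h = 0} the values of f do not matter. As h ∘ φ ≠ 0 a.e. where
w ≠ 0, the solution is w (f ∘ φ) / (h ∘ φ).

It remains to factor h ∘ φ as the product of `h_φ ∘ φ` and `E_φ(|w|²)`
(`hDeriv_comp_eq_mul_wcondExp`). Density of the two domains enters through `hDeriv_lt_top`: it makes
T* and the finite-valued calculus with h available, and it makes the conditional expectation
meaningful. -/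

theorem measurable_hDeriv : Measurable (hDeriv μ φ w) :=
  Measure.measurable_rnDeriv _ _

theorem weightMeasure_one : weightMeasure μ 1 = μ := by
  simp [weightMeasure]

theorem withDensity_hDeriv [SigmaFinite μ] (hac : weightImage μ φ w ≪ μ) :
    μ.withDensity (hDeriv μ φ w) = weightImage μ φ w := by
  have : SFinite (weightImage μ φ w) := by
    unfold weightImage weightMeasure
    infer_instance
  exact Measure.withDensity_rnDeriv_eq _ _ hac

theorem lintegral_weight_mul_comp [SigmaFinite μ] (hφ : Measurable φ) (hw : Measurable w)
    (hac : weightImage μ φ w ≪ μ) {F : X → ℝ≥0∞} (hF : Measurable F) :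
    ∫⁻ x, ‖w x‖ₑ ^ 2 * F (φ x) ∂μ = ∫⁻ y, hDeriv μ φ w y * F y ∂μ := by
  have h1 : ∫⁻ y, F y ∂(weightImage μ φ w) = ∫⁻ x, ‖w x‖ₑ ^ 2 * F (φ x) ∂μ := by
    rw [weightImage, lintegral_map hF hφ, weightMeasure,
      lintegral_withDensity_eq_lintegral_mul _ (by fun_prop) (by fun_prop)]
    rfl
  rw [← h1, ← withDensity_hDeriv hac,
    lintegral_withDensity_eq_lintegral_mul _ measurable_hDeriv hF]
  rfl

theorem integral_weight_mul_comp [SigmaFinite μ] (hφ : Measurable φ) (hw : Measurable w)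
    (hac : weightImage μ φ w ≪ μ) (hfin : ∀ᵐ y ∂μ, hDeriv μ φ w y < ∞)
    {F : X → ℂ} (hF : Measurable F) :
    ∫ x, ((‖w x‖ ^ 2 : ℝ) : ℂ) * F (φ x) ∂μ = ∫ y, ((hDeriv μ φ w y).toReal : ℂ) * F y ∂μ := by
  have h1 : ∫ y, F y ∂(weightImage μ φ w) = ∫ x, ((‖w x‖ ^ 2 : ℝ) : ℂ) * F (φ x) ∂μ := by
    rw [weightImage, integral_map hφ.aemeasurable hF.aestronglyMeasurable, weightMeasure,
      integral_withDensity_eq_integral_toReal_smul (by fun_prop)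
        (by filter_upwards with x using by simp)]
    simp
  rw [← h1, ← withDensity_hDeriv hac,
    integral_withDensity_eq_integral_toReal_smul measurable_hDeriv hfin]
  simp

/-- A density is nonzero a.e. for the measure it defines, here `μ_w ∘ φ⁻¹`; pull this back along
`φ`. -/
theorem hDeriv_comp_ne_zero [SigmaFinite μ] (hφ : Measurable φ) (hw : Measurable w)
    (hac : weightImage μ φ w ≪ μ) : ∀ᵐ x ∂μ, w x ≠ 0 → hDeriv μ φ w (φ x) ≠ 0 := by
  have h1 : ∀ᵐ y ∂(weightImage μ φ w), hDeriv μ φ w y ≠ 0 := by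
    rw [← withDensity_hDeriv hac, ae_withDensity_iff measurable_hDeriv]
    exact .of_forall fun _ => id
  have h2 := ae_of_ae_map hφ.aemeasurable h1
  rw [weightMeasure, ae_withDensity_iff (by fun_prop)] at h2
  filter_upwards [h2] with x hx hwx
  exact hx (by simpa using hwx)

theorem memLp_two_iff {f : X → ℂ} (hf : AEStronglyMeasurable f μ) :
    MemLp f 2 μ ↔ ∫⁻ x, ‖f x‖ₑ ^ 2 ∂μ < ∞ := by
  have := eLpNorm_lt_top_iff_lintegral_rpow_enorm_lt_top (f := f) (μ := μ)
    (p := 2) (by simp) (by simp)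
  simp only [MemLp, hf, true_and, this]
  simp

theorem lintegral_enorm_weight_mul_comp [SigmaFinite μ] (hφ : Measurable φ) (hw : Measurable w)
    (hac : weightImage μ φ w ≪ μ) {F : X → ℂ} (hF : Measurable F) :
    ∫⁻ x, ‖w x * F (φ x)‖ₑ ^ 2 ∂μ = ∫⁻ y, hDeriv μ φ w y * ‖F y‖ₑ ^ 2 ∂μ := by
  rw [← lintegral_weight_mul_comp hφ hw hac (by fun_prop)]
  simp only [enorm_mul, mul_pow]

/-- For f in the domain, h |f|² is integrable, so f vanishes a.e. where h = ∞. The indicator of a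
finite-measure piece of that set is then orthogonal to a dense subspace, hence zero. -/
theorem hDeriv_lt_top [SigmaFinite μ] (hφ : Measurable φ) (hw : Measurable w)
    (hac : weightImage μ φ w ≪ μ)
    (hd : Dense ((wcompOp μ hφ hw hac).domain : Set (Lp ℂ 2 μ))) :
    ∀ᵐ y ∂μ, hDeriv μ φ w y < ∞ := by
  have hmeas : MeasurableSet {y | hDeriv μ φ w y = ∞} :=
    measurable_hDeriv (measurableSet_singleton _)
  have hzero : ∀ n, μ ({y | hDeriv μ φ w y = ∞} ∩ spanningSets μ n) = 0 := by
    intro n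
    set B := {y | hDeriv μ φ w y = ∞} ∩ spanningSets μ n
    have hB : MeasurableSet B := hmeas.inter (measurableSet_spanningSets μ n)
    have hμB : μ B ≠ ∞ :=
      (measure_mono Set.inter_subset_right |>.trans_lt (measure_spanningSets_lt_top μ n)).ne
    have h0 : indicatorConstLp 2 hB hμB (1 : ℂ) = 0 := by
      refine hd.eq_zero_of_inner_left ℂ fun f hf => ?_
      rw [L2.inner_indicatorConstLp_one]
      refine setIntegral_eq_zero_of_ae_eq_zero ?_
      have hf' : MemLp (fun x => w x * f (φ x)) 2 μ := hf
      have h2 := (memLp_two_iff hf'.1).1 hf'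
      rw [lintegral_enorm_weight_mul_comp hφ hw hac (Lp.stronglyMeasurable f).measurable] at h2
      have hm : Measurable fun y => hDeriv μ φ w y * ‖f y‖ₑ ^ 2 :=
        measurable_hDeriv.mul ((Lp.stronglyMeasurable f).measurable.enorm.pow_const _)
      filter_upwards [ae_lt_top hm h2.ne] with y hy hyB
      by_contra hne
      rw [show hDeriv μ φ w y = ∞ from hyB.1, ENNReal.top_mul (by simpa using hne)] at hy
      exact lt_irrefl _ hy
    have h1 := norm_indicatorConstLp (p := 2) (hs := hB) (hμs := hμB) (c := (1 : ℂ))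
      (by simp) (by simp)
    rw [h0] at h1
    have h3 : μ.real B = 0 := by
      by_contra hne
      have : 0 < μ.real B := lt_of_le_of_ne measureReal_nonneg (Ne.symm hne)
      have := Real.rpow_pos_of_pos this (1 / (2 : ℝ≥0∞).toReal)
      simp at h1
      simp at this
      linarith
    exact (measureReal_eq_zero_iff hμB).1 h3
  rw [ae_iff]
  have : {a | ¬hDeriv μ φ w a < ∞} =
      ⋃ n, ({y | hDeriv μ φ w y = ∞} ∩ spanningSets μ n) := by
    rw [← Set.inter_iUnion, iUnion_spanningSets, Set.inter_univ]
    ext; simp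
  rw [this, measure_iUnion_null hzero]

/-- The conditional expectation has the form e ∘ φ, and both `h_{φ,w}` and `h_φ` e are densities of
`μ_w ∘ φ⁻¹`. They agree μ-a.e., and `μ ∘ φ⁻¹ ≪ μ` carries this to the points φ x. -/
theorem hDeriv_comp_eq_mul_wcondExp [SigmaFinite μ] (hφ : Measurable φ)
    (hac₁ : weightImage μ φ 1 ≪ μ) (hac : weightImage μ φ w ≪ μ)
    (hfin : ∀ᵐ y ∂μ, hDeriv μ φ 1 y < ∞) :
    ∀ᵐ x ∂μ, hDeriv μ φ w (φ x) =
      hDeriv μ φ 1 (φ x) * wcondExp μ φ 1 (fun y => ‖w y‖ₑ ^ 2) x := by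
  have hmap : μ.withDensity (hDeriv μ φ 1) = μ.map φ := by
    rw [withDensity_hDeriv hac₁, weightImage, weightMeasure_one]
  have hsf : SigmaFinite (μ.map φ) := by
    rw [← hmap]
    exact SigmaFinite.withDensity_of_ne_top (hfin.mono fun _ h => h.ne)
  -- The averaging identity for `condLExp` used below needs μ to be σ-finite on `φ⁻¹(𝒜)`. This holds
  -- because `μ ∘ φ⁻¹` has an a.e. finite density.
  have htrim : SigmaFinite (μ.trim hφ.comap_le) := by
    refine @SigmaFinite.of_map X X (MeasurableSpace.comap φ inferInstance) _ _ φ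
      (comap_measurable φ).aemeasurable ?_
    rw [map_trim_comap hφ]
    exact hsf
  obtain ⟨e, he, heq⟩ := (measurable_condLExp (MeasurableSpace.comap φ inferInstance) μ
    (fun y => ‖w y‖ₑ ^ 2)).exists_eq_measurable_comp
  have hE : wcondExp μ φ 1 (fun y => ‖w y‖ₑ ^ 2) = e ∘ φ := by
    rw [wcondExp, weightMeasure_one, heq]
  have key : μ.withDensity (hDeriv μ φ w) = μ.withDensity (hDeriv μ φ 1 * e) := by
    ext s hs
    rw [withDensity_hDeriv hac, withDensity_mul _ measurable_hDeriv he, hmap,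
      withDensity_apply _ hs, setLIntegral_map hs he hφ, weightImage,
      Measure.map_apply hφ hs, weightMeasure, withDensity_apply _ (hφ hs),
      ← setLIntegral_condLExp hφ.comap_le μ _ ⟨s, hs, rfl⟩, heq]
    rfl
  have hae := (withDensity_eq_iff_of_sigmaFinite measurable_hDeriv.aemeasurable
    (measurable_hDeriv.mul he).aemeasurable).1 key
  have h1 : ∀ᵐ y ∂(μ.map φ), hDeriv μ φ w y = (hDeriv μ φ 1 * e) y := by
    rw [weightImage, weightMeasure_one] at hac₁
    exact hac₁.ae_le hae
  filter_upwards [ae_of_ae_map hφ.aemeasurable h1] with x hx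
  rw [hx, hE]
  rfl

/-- Sets of finite measure on which h, a and b are bounded exhaust X up to a null set. Only sets
with h bounded are tested because their indicators lie in the domain of `C_{φ,w}`. -/
theorem ae_eq_of_forall_setIntegral_eq_of_bounded [SigmaFinite μ] {h : X → ℝ≥0∞}
    (hh : Measurable h) (hfin : ∀ᵐ y ∂μ, h y < ∞) {a b : X → ℂ} (ha : Measurable a)
    (hb : Measurable b)
    (hab : ∀ B, MeasurableSet B → μ B < ∞ → (∃ n : ℕ, ∀ x ∈ B, h x ≤ n) →
      ∫ x in B, a x ∂μ = ∫ x in B, b x ∂μ) : a =ᵐ[μ] b := by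
  let E : ℕ → Set X := fun n =>
    spanningSets μ n ∩ ({x | h x ≤ n} ∩ ({x | ‖a x‖ ≤ n} ∩ {x | ‖b x‖ ≤ n}))
  have hE : ∀ n, MeasurableSet (E n) := fun n =>
    (measurableSet_spanningSets μ n).inter ((measurableSet_le hh measurable_const).inter
      ((measurableSet_le ha.norm measurable_const).inter
        (measurableSet_le hb.norm measurable_const)))
  have hμE : ∀ n, μ (E n) < ∞ := fun n =>
    (measure_mono Set.inter_subset_left).trans_lt (measure_spanningSets_lt_top μ n)
  have hn : ∀ n, ∀ᵐ x ∂μ, x ∈ E n → a x = b x := by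
    intro n
    rw [← ae_restrict_iff' (hE n)]
    refine Integrable.ae_eq_of_forall_setIntegral_eq _ _ ?_ ?_ fun s hs _ => ?_
    · refine Measure.integrableOn_of_bounded (M := n) (hμE n).ne ha.aestronglyMeasurable ?_
      filter_upwards [ae_restrict_mem (hE n)] with x hx using hx.2.2.1
    · refine Measure.integrableOn_of_bounded (M := n) (hμE n).ne hb.aestronglyMeasurable ?_
      filter_upwards [ae_restrict_mem (hE n)] with x hx using hx.2.2.2
    · rw [Measure.restrict_restrict hs]
      exact hab _ (hs.inter (hE n))
        ((measure_mono Set.inter_subset_right).trans_lt (hμE n)) ⟨n, fun x hx => hx.2.2.1⟩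
  filter_upwards [ae_all_iff.2 hn, hfin] with x hx hfx
  obtain ⟨n₁, h₁⟩ := Set.mem_iUnion.1
    ((iUnion_spanningSets μ).symm ▸ Set.mem_univ x : x ∈ ⋃ n, spanningSets μ n)
  obtain ⟨n₂, h₂⟩ := ENNReal.exists_nat_gt hfx.ne
  obtain ⟨n₃, h₃⟩ := exists_nat_ge ‖a x‖
  obtain ⟨n₄, h₄⟩ := exists_nat_ge ‖b x‖
  refine hx (n₁ + n₂ + n₃ + n₄) ⟨?_, ?_, ?_, ?_⟩
  · exact monotone_spanningSets μ (by omega) h₁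
  · exact h₂.le.trans (by exact_mod_cast (by omega : n₂ ≤ n₁ + n₂ + n₃ + n₄))
  · exact h₃.trans (by exact_mod_cast (by omega : n₃ ≤ n₁ + n₂ + n₃ + n₄))
  · exact h₄.trans (by exact_mod_cast (by omega : n₄ ≤ n₁ + n₂ + n₃ + n₄))

end Density

/-! ### The adjoint of `C_{φ,w}` and its reciprocal. -/

section Adjoint

open Filter Topology ComplexConjugate

/-- R(T)ᗮ is contained in N(T*); take orthogonal complements. -/
theorem orthogonal_pmapKer_adjoint_le {𝕜 E F : Type*} [RCLike 𝕜]
    [NormedAddCommGroup E] [InnerProductSpace 𝕜 E] [CompleteSpace E]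
    [NormedAddCommGroup F] [InnerProductSpace 𝕜 F] [CompleteSpace F]
    {T : E →ₗ.[𝕜] F} (hT : Dense (T.domain : Set E)) :
    (pmapKer T.adjoint)ᗮ ≤ (pmapRange T).topologicalClosure := by
  rw [← Submodule.orthogonal_orthogonal_eq_closure]
  refine Submodule.orthogonal_le fun v hv => ?_
  have h0 : ∀ x : T.domain, inner 𝕜 (0 : E) (x : E) = inner 𝕜 v (T x) := fun x => by
    rw [inner_zero_left, (Submodule.mem_orthogonal' _ _).1 hv (T x) (mem_pmapRange.2 ⟨x, rfl⟩)]
  exact mem_pmapKer.2 ⟨⟨v, LinearPMap.mem_adjoint_domain_of_exists v ⟨0, h0⟩⟩,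
    LinearPMap.adjoint_apply_eq hT _ h0, rfl⟩

variable {X : Type*} [MeasurableSpace X] {μ : Measure X} {φ : X → X} {w : X → ℂ}
  {hφ : Measurable φ} {hw : Measurable w} {hac : weightImage μ φ w ≪ μ}

theorem weight_mul_comp_congr (hφ : Measurable φ) (hw : Measurable w)
    (hac : weightImage μ φ w ≪ μ) {F G : X → ℂ} (h : F =ᵐ[μ] G) :
    (fun x => w x * F (φ x)) =ᵐ[μ] fun x => w x * G (φ x) := by
  filter_upwards [ae_comp_of_weight_ne_zero hφ hw hac h] with x hx
  by_cases h0 : w x = 0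
  · simp [h0]
  · rw [hx h0]

theorem wcompOp_coeFn (u : (wcompOp μ hφ hw hac).domain) :
    (wcompOp μ hφ hw hac u : X → ℂ) =ᵐ[μ] fun x => w x * (u : Lp ℂ 2 μ) (φ x) :=
  MemLp.coeFn_toLp u.2

theorem toLp_mem_wcompOp_domain {k : X → ℂ} (hk : MemLp k 2 μ)
    (hwk : MemLp (fun x => w x * k (φ x)) 2 μ) :
    ∃ h : hk.toLp k ∈ (wcompOp μ hφ hw hac).domain,
      (wcompOp μ hφ hw hac ⟨hk.toLp k, h⟩ : X → ℂ) =ᵐ[μ] fun x => w x * k (φ x) := by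
  have h1 := weight_mul_comp_congr hφ hw hac hk.coeFn_toLp
  have h2 : MemLp (fun x => w x * hk.toLp k (φ x)) 2 μ := hwk.ae_eq h1.symm
  exact ⟨h2, (wcompOp_coeFn (hφ := hφ) (hw := hw) (hac := hac) ⟨hk.toLp k, h2⟩).trans h1⟩

/-- The functions of the form `w · (k ∘ φ)` in `L²(μ)` are closed. -/
theorem exists_eq_weight_mul_comp_of_mem_closure {g : Lp ℂ 2 μ}
    (hg : g ∈ (pmapRange (wcompOp μ hφ hw hac)).topologicalClosure) :
    ∃ k : X → ℂ, Measurable k ∧ g =ᵐ[μ] fun x => w x * k (φ x) := by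
  rw [← SetLike.mem_coe, Submodule.topologicalClosure_coe, mem_closure_iff_seq_limit] at hg
  obtain ⟨t, ht, hlim⟩ := hg
  choose u hu using fun n => mem_pmapRange.1 (ht n)
  obtain ⟨ns, -, hns⟩ := (tendstoInMeasure_of_tendsto_Lp hlim).exists_seq_tendsto_ae
  -- Along an a.e. convergent subsequence, u_n(φ x) converges for almost every x with w x ≠ 0. The
  -- default value of `limUnder` elsewhere is harmless.
  refine ⟨fun y => atTop.limUnder fun n => (u (ns n) : Lp ℂ 2 μ) y,
    (StronglyMeasurable.limUnder fun n => Lp.stronglyMeasurable _).measurable, ?_⟩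
  have hall := ae_all_iff.2 fun n => wcompOp_coeFn (u (ns n))
  filter_upwards [hns, hall] with x hx hux
  have h1 : Tendsto (fun n => w x * (u (ns n) : Lp ℂ 2 μ) (φ x)) atTop (𝓝 (g x)) := by
    refine hx.congr fun n => ?_
    rw [← hu, hux]
  by_cases h0 : w x = 0
  · simp only [h0, zero_mul] at h1 ⊢
    exact tendsto_nhds_unique h1 tendsto_const_nhds
  · have h2 : Tendsto (fun n => (u (ns n) : Lp ℂ 2 μ) (φ x)) atTop (𝓝 ((w x)⁻¹ * g x)) := by
      refine (h1.const_mul (w x)⁻¹).congr fun n => ?_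
      rw [inv_mul_cancel_left₀ h0]
    rw [h2.limUnder_eq, mul_inv_cancel_left₀ h0]

theorem memLp_indicator_one {B : Set X} (hB : MeasurableSet B) (hμB : μ B < ∞) :
    MemLp (B.indicator fun _ => (1 : ℂ)) 2 μ :=
  memLp_indicator_const 2 hB 1 (.inr hμB.ne)

theorem memLp_hDeriv_mul_indicator {B : Set X} (hB : MeasurableSet B) (hμB : μ B < ∞)
    {n : ℕ} (hn : ∀ x ∈ B, hDeriv μ φ w x ≤ n) :
    MemLp (fun y => ((hDeriv μ φ w y).toReal : ℂ) * B.indicator (fun _ => (1 : ℂ)) y) 2 μ := by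
  have hm : Measurable (B.indicator fun _ => (1 : ℂ)) := measurable_const.indicator hB
  refine ((memLp_indicator_one hB hμB).const_mul (n : ℂ)).mono
    ((Complex.measurable_ofReal.comp measurable_hDeriv.ennreal_toReal).mul
      hm).aestronglyMeasurable (.of_forall fun y => ?_)
  by_cases hy : y ∈ B
  · simpa [hy] using ENNReal.toReal_mono (by simp) (hn y hy)
  · simp [hy]

theorem inner_toLp_indicator {B : Set X} (hB : MeasurableSet B) (hμB : μ B < ∞)
    (p : Lp ℂ 2 μ) :
    inner ℂ ((memLp_indicator_one hB hμB).toLp _) p = ∫ x in B, p x ∂μ :=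
  L2.inner_indicatorConstLp_one hB hμB.ne p

variable [SigmaFinite μ]

theorem inner_wcompOp (hfin : ∀ᵐ y ∂μ, hDeriv μ φ w y < ∞) {g : Lp ℂ 2 μ} {k : X → ℂ}
    (hk : Measurable k) (hg : g =ᵐ[μ] fun x => w x * k (φ x))
    (u : (wcompOp μ hφ hw hac).domain) :
    inner ℂ g (wcompOp μ hφ hw hac u) =
      ∫ y, ((hDeriv μ φ w y).toReal : ℂ) * ((u : Lp ℂ 2 μ) y * conj (k y)) ∂μ := by
  have hF : Measurable fun y => (u : Lp ℂ 2 μ) y * conj (k y) :=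
    (Lp.stronglyMeasurable (u : Lp ℂ 2 μ)).measurable.mul
      (Complex.continuous_conj.measurable.comp hk)
  rw [← integral_weight_mul_comp hφ hw hac hfin hF, L2.inner_def]
  refine integral_congr_ae ?_
  filter_upwards [hg, wcompOp_coeFn u] with x h1 h2
  rw [RCLike.inner_apply, h1, h2, map_mul, Complex.ofReal_pow, ← Complex.mul_conj']
  ring

theorem adjoint_wcompOp_apply (hfin : ∀ᵐ y ∂μ, hDeriv μ φ w y < ∞)
    (hd : Dense ((wcompOp μ hφ hw hac).domain : Set (Lp ℂ 2 μ)))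
    {g p : Lp ℂ 2 μ} {k : X → ℂ}
    (hk : Measurable k) (hg : g =ᵐ[μ] fun x => w x * k (φ x))
    (hp : p =ᵐ[μ] fun y => ((hDeriv μ φ w y).toReal : ℂ) * k y) :
    ∃ h : g ∈ (wcompOp μ hφ hw hac).adjoint.domain,
      (wcompOp μ hφ hw hac).adjoint ⟨g, h⟩ = p := by
  have h0 : ∀ u : (wcompOp μ hφ hw hac).domain,
      inner ℂ p (u : Lp ℂ 2 μ) = inner ℂ g (wcompOp μ hφ hw hac u) := by
    intro u
    rw [inner_wcompOp hfin hk hg, L2.inner_def]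
    refine integral_congr_ae ?_
    filter_upwards [hp] with y hy
    rw [RCLike.inner_apply, hy, map_mul, Complex.conj_ofReal]
    ring
  exact ⟨LinearPMap.mem_adjoint_domain_of_exists g ⟨p, h0⟩,
    LinearPMap.adjoint_apply_eq hd ⟨g, _⟩ h0⟩

theorem memLp_weight_mul_indicator (hφ : Measurable φ) (hw : Measurable w)
    (hac : weightImage μ φ w ≪ μ) {B : Set X} (hB : MeasurableSet B) (hμB : μ B < ∞) {n : ℕ}
    (hn : ∀ x ∈ B, hDeriv μ φ w x ≤ n) :
    MemLp (fun x => w x * B.indicator (fun _ => (1 : ℂ)) (φ x)) 2 μ := by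
  have hm : Measurable (B.indicator fun _ => (1 : ℂ)) := measurable_const.indicator hB
  have hwm : Measurable fun x => w x * B.indicator (fun _ => (1 : ℂ)) (φ x) :=
    hw.mul (hm.comp hφ)
  rw [memLp_two_iff hwm.aestronglyMeasurable,
    lintegral_enorm_weight_mul_comp hφ hw hac hm]
  calc ∫⁻ y, hDeriv μ φ w y * ‖B.indicator (fun _ => (1 : ℂ)) y‖ₑ ^ 2 ∂μ
      ≤ ∫⁻ y, B.indicator (fun _ => (n : ℝ≥0∞)) y ∂μ := by
        refine lintegral_mono fun y => ?_
        by_cases hy : y ∈ B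
        · simpa [hy] using hn y hy
        · simp [hy]
    _ = n * μ B := by rw [lintegral_indicator_const hB]
    _ < ∞ := ENNReal.mul_lt_top (by simp) hμB

/-- Testing against indicators identifies the adjoint on functions `w · (k ∘ φ)`. -/
theorem adjoint_wcompOp_coeFn (hfin : ∀ᵐ y ∂μ, hDeriv μ φ w y < ∞)
    (hd : Dense ((wcompOp μ hφ hw hac).domain : Set (Lp ℂ 2 μ)))
    (g : (wcompOp μ hφ hw hac).adjoint.domain) {k : X → ℂ}
    (hk : Measurable k) (hg : (g : Lp ℂ 2 μ) =ᵐ[μ] fun x => w x * k (φ x)) :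
    (wcompOp μ hφ hw hac).adjoint g =ᵐ[μ] fun y => ((hDeriv μ φ w y).toReal : ℂ) * k y := by
  refine ae_eq_of_forall_setIntegral_eq_of_bounded measurable_hDeriv hfin
    (Lp.stronglyMeasurable _).measurable
    ((Complex.measurable_ofReal.comp measurable_hDeriv.ennreal_toReal).mul hk) ?_
  rintro B hB hμB ⟨n, hn⟩
  obtain ⟨hu, -⟩ := toLp_mem_wcompOp_domain (hφ := hφ) (hw := hw) (hac := hac)
    (memLp_indicator_one hB hμB) (memLp_weight_mul_indicator hφ hw hac hB hμB hn)
  have h1 := LinearPMap.adjoint_isFormalAdjoint hd g ⟨_, hu⟩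
  rw [inner_wcompOp hfin hk hg, ← inner_conj_symm, inner_toLp_indicator hB hμB] at h1
  -- The indicator sits in the second slot of the inner product, so `h1` computes the conjugate of
  -- the wanted integral.
  rw [← Complex.conj_conj (∫ x in B, _ ∂μ), h1, ← integral_conj, ← integral_indicator hB]
  refine integral_congr_ae ?_
  filter_upwards [(memLp_indicator_one hB hμB).coeFn_toLp] with y hy
  simp only [hy, map_mul, Complex.conj_ofReal, Complex.conj_conj]
  by_cases hyB : y ∈ B <;> simp [hyB]

/-- For B of finite measure with h bounded on B, the function h 1_B is the image under T* of w (1_B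
∘ φ). Thus h r integrates to zero over every such B, and h r = 0 a.e. -/
theorem ae_eq_zero_of_mem_orthogonal_range (hfin : ∀ᵐ y ∂μ, hDeriv μ φ w y < ∞)
    (hd : Dense ((wcompOp μ hφ hw hac).domain : Set (Lp ℂ 2 μ))) {r : Lp ℂ 2 μ}
    (hr : r ∈ (pmapRange (wcompOp μ hφ hw hac).adjoint)ᗮ) :
    ∀ᵐ y ∂μ, hDeriv μ φ w y ≠ 0 → r y = 0 := by
  have h1 : (fun y => ((hDeriv μ φ w y).toReal : ℂ) * r y) =ᵐ[μ] fun _ => 0 := by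
    refine ae_eq_of_forall_setIntegral_eq_of_bounded measurable_hDeriv hfin
      ((Complex.measurable_ofReal.comp measurable_hDeriv.ennreal_toReal).mul
        (Lp.stronglyMeasurable _).measurable) measurable_const ?_
    rintro B hB hμB ⟨n, hn⟩
    have hp := memLp_hDeriv_mul_indicator (μ := μ) (φ := φ) (w := w) hB hμB hn
    obtain ⟨hv, h2⟩ := adjoint_wcompOp_apply hfin hd (measurable_const.indicator hB)
      (memLp_weight_mul_indicator hφ hw hac hB hμB hn).coeFn_toLp hp.coeFn_toLp
    have h3 := (Submodule.mem_orthogonal _ _).1 hr _ (mem_pmapRange.2 ⟨_, h2⟩)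
    rw [L2.inner_def] at h3
    rw [integral_zero, ← h3, ← integral_indicator hB]
    refine integral_congr_ae ?_
    filter_upwards [hp.coeFn_toLp] with y hy
    rw [RCLike.inner_apply, hy]
    by_cases hyB : y ∈ B <;> simp [hyB, mul_comm]
  filter_upwards [h1, hfin] with y hy hlt hne
  exact (mul_eq_zero.1 hy).resolve_left
    (by simpa using (ENNReal.toReal_ne_zero.2 ⟨hne, hlt.ne⟩))

/-- Since k need not be in L², g need not be in R(T). Truncating k to E_n gives elements of D(T)
whose images are g restricted to φ⁻¹(E_n). These are orthogonal to N(T*), and the sets φ⁻¹(E_n)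
increase to X. -/
theorem mem_orthogonal_ker_adjoint (hd : Dense ((wcompOp μ hφ hw hac).domain : Set (Lp ℂ 2 μ)))
    {g : Lp ℂ 2 μ} {k : X → ℂ} (hk : Measurable k) (hg : g =ᵐ[μ] fun x => w x * k (φ x)) :
    g ∈ (pmapKer (wcompOp μ hφ hw hac).adjoint)ᗮ := by
  refine (Submodule.mem_orthogonal _ _).2 fun v hv => ?_
  obtain ⟨v, hv0, rfl⟩ := mem_pmapKer.1 hv
  let E : ℕ → Set X := fun n => spanningSets μ n ∩ {y | ‖k y‖ ≤ n}
  have hE : ∀ n, MeasurableSet (E n) := fun n =>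
    (measurableSet_spanningSets μ n).inter (measurableSet_le hk.norm measurable_const)
  have hμE : ∀ n, μ (E n) < ∞ := fun n =>
    (measure_mono Set.inter_subset_left).trans_lt (measure_spanningSets_lt_top μ n)
  have hmono : Monotone fun n => φ ⁻¹' E n := fun m n hmn =>
    Set.preimage_mono (Set.inter_subset_inter (monotone_spanningSets μ hmn)
      fun y (hy : ‖k y‖ ≤ m) => hy.trans (by exact_mod_cast hmn))
  have hunion : ⋃ n, φ ⁻¹' E n = Set.univ := by
    refine Set.eq_univ_of_forall fun x => Set.mem_iUnion.2 ?_
    obtain ⟨n₁, h₁⟩ := Set.mem_iUnion.1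
      ((iUnion_spanningSets μ).symm ▸ Set.mem_univ (φ x) : φ x ∈ ⋃ n, spanningSets μ n)
    obtain ⟨n₂, h₂⟩ := exists_nat_ge ‖k (φ x)‖
    exact ⟨n₁ + n₂, monotone_spanningSets μ (by omega) h₁,
      h₂.trans (by exact_mod_cast (by omega : n₂ ≤ n₁ + n₂))⟩
  have hlim := tendsto_setIntegral_of_monotone (fun n => hφ (hE n)) hmono
    (L2.integrable_inner (𝕜 := ℂ) (v : Lp ℂ 2 μ) g).integrableOn
  rw [hunion, setIntegral_univ, ← L2.inner_def] at hlim
  refine tendsto_nhds_unique hlim (tendsto_const_nhds.congr fun n => ?_)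
  have hum : Measurable ((E n).indicator k) := hk.indicator (hE n)
  have hu : MemLp ((E n).indicator k) 2 μ := by
    refine ((memLp_indicator_one (hE n) (hμE n)).const_mul (n : ℂ)).mono
      hum.aestronglyMeasurable (.of_forall fun y => ?_)
    by_cases hy : y ∈ E n
    · simpa [hy] using hy.2
    · simp [hy]
  have hwu : MemLp (fun x => w x * (E n).indicator k (φ x)) 2 μ := by
    refine (Lp.memLp g).mono (hw.mul (hum.comp hφ)).aestronglyMeasurable ?_
    filter_upwards [hg] with x hx
    rw [hx]
    by_cases hy : φ x ∈ E n <;> simp [hy, mul_nonneg]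
  obtain ⟨hmem, hT⟩ := toLp_mem_wcompOp_domain (hφ := hφ) (hw := hw) (hac := hac) hu hwu
  have h1 := LinearPMap.adjoint_isFormalAdjoint hd v ⟨_, hmem⟩
  rw [hv0, inner_zero_left, L2.inner_def] at h1
  rw [h1, ← integral_indicator (hφ (hE n))]
  refine integral_congr_ae ?_
  filter_upwards [hT, hg] with x h2 h3
  rw [h2]
  by_cases hy : φ x ∈ E n
  · simp [hy, h3]
  · simp [hy]

theorem mem_graph_reciprocal_adjoint_wcompOp_iff
    (hd : Dense ((wcompOp μ hφ hw hac).domain : Set (Lp ℂ 2 μ))) {f g : Lp ℂ 2 μ} :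
    (f, g) ∈ (reciprocal (wcompOp μ hφ hw hac).adjoint).graph ↔
      g =ᵐ[μ] fun x => w x * f (φ x) / ((hDeriv μ φ w (φ x)).toReal : ℂ) := by
  have hfin := hDeriv_lt_top hφ hw hac hd
  have hne : ∀ᵐ x ∂μ, w x ≠ 0 → ((hDeriv μ φ w (φ x)).toReal : ℂ) ≠ 0 := by
    filter_upwards [hDeriv_comp_ne_zero hφ hw hac, ae_comp_of_weight_ne_zero hφ hw hac hfin]
      with x h1 h2 hwx
    exact_mod_cast ENNReal.toReal_ne_zero.2 ⟨h1 hwx, (h2 hwx).ne⟩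
  rw [graph_reciprocal]
  constructor
  · rintro ⟨g, rfl, hg, hfg⟩
    obtain ⟨k, hk, hgk⟩ :=
      exists_eq_weight_mul_comp_of_mem_closure (orthogonal_pmapKer_adjoint_le hd hg)
    have h1 := adjoint_wcompOp_coeFn hfin hd g hk hgk
    have h2 := ae_eq_zero_of_mem_orthogonal_range hfin hd hfg
    have h3 : ∀ᵐ y ∂μ, hDeriv μ φ w y ≠ 0 → f y = ((hDeriv μ φ w y).toReal : ℂ) * k y := by
      filter_upwards [h1, h2, Lp.coeFn_sub f ((wcompOp μ hφ hw hac).adjoint g)]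
        with y hy1 hy2 hy3 hy
      have := hy2 hy
      rw [hy3, Pi.sub_apply, sub_eq_zero] at this
      rw [this, hy1]
    filter_upwards [hgk, hne, hDeriv_comp_ne_zero hφ hw hac,
      ae_comp_of_weight_ne_zero hφ hw hac h3] with x hx hnx hzx hfx
    rw [hx]
    by_cases h0 : w x = 0
    · simp [h0]
    · rw [hfx h0 (hzx h0)]
      field_simp [hnx h0]
  · intro hg
    have hfm : Measurable f := (Lp.stronglyMeasurable f).measurable
    have hhm : Measurable fun y => ((hDeriv μ φ w y).toReal : ℂ) :=
      Complex.measurable_ofReal.comp measurable_hDeriv.ennreal_toReal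
    have hk : Measurable fun y => f y / ((hDeriv μ φ w y).toReal : ℂ) := hfm.div hhm
    have hgk : g =ᵐ[μ] fun x =>
        w x * (fun y => f y / ((hDeriv μ φ w y).toReal : ℂ)) (φ x) := by
      filter_upwards [hg] with x hx
      rw [hx, mul_div_assoc]
    have hS : MeasurableSet {y | hDeriv μ φ w y ≠ 0} :=
      (measurable_hDeriv (measurableSet_singleton 0)).compl
    -- With k = f / h and division by zero giving 0, h k is f cut off to {h ≠ 0}. It is in L² even
    -- when k is not.
    have hp : MemLp ({y | hDeriv μ φ w y ≠ 0}.indicator f) 2 μ := (Lp.memLp f).indicator hS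
    have hpk : hp.toLp _ =ᵐ[μ] fun y => ((hDeriv μ φ w y).toReal : ℂ) *
        (f y / ((hDeriv μ φ w y).toReal : ℂ)) := by
      filter_upwards [hp.coeFn_toLp, hfin] with y hy hlt
      rw [hy]
      by_cases h0 : hDeriv μ φ w y = 0
      · simp [h0]
      · have : ((hDeriv μ φ w y).toReal : ℂ) ≠ 0 := by
          exact_mod_cast ENNReal.toReal_ne_zero.2 ⟨h0, hlt.ne⟩
        rw [mul_div_cancel₀ _ this]
        simp [h0]
    obtain ⟨hmem, hT⟩ := adjoint_wcompOp_apply hfin hd hk hgk hpk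
    refine ⟨⟨g, hmem⟩, rfl, mem_orthogonal_ker_adjoint hd hk hgk, ?_⟩
    rw [hT]
    have hr0 : ∀ᵐ y ∂μ, hDeriv μ φ w y ≠ 0 → (f - hp.toLp _ : Lp ℂ 2 μ) y = 0 := by
      filter_upwards [hp.coeFn_toLp, Lp.coeFn_sub f (hp.toLp _)] with y hy1 hy2 hy
      rw [hy2, Pi.sub_apply, hy1]
      simp [hy]
    set r := f - hp.toLp _
    -- The remainder r = f - T* g lives on {h = 0}, which φ x avoids for almost every x with w x ≠
    -- 0. So r lies in N(T), which is orthogonal to R(T*).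
    have hTr : (fun x => w x * r (φ x)) =ᵐ[μ] 0 := by
      filter_upwards [hDeriv_comp_ne_zero hφ hw hac,
        ae_comp_of_weight_ne_zero hφ hw hac hr0] with x h1 h2
      by_cases h0 : w x = 0
      · simp [h0]
      · simp [h2 h0 (h1 h0)]
    have hrmem : r ∈ (wcompOp μ hφ hw hac).domain := MemLp.zero.ae_eq hTr.symm
    have hTr0 : wcompOp μ hφ hw hac ⟨r, hrmem⟩ = 0 :=
      Lp.ext (((wcompOp_coeFn ⟨r, hrmem⟩).trans hTr).trans (Lp.coeFn_zero ℂ 2 μ).symm)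
    refine (Submodule.mem_orthogonal _ _).2 fun v hv => ?_
    obtain ⟨v, rfl⟩ := mem_pmapRange.1 hv
    have := LinearPMap.adjoint_isFormalAdjoint hd v ⟨r, hrmem⟩
    rw [hTr0, inner_zero_right] at this
    exact this

end Adjoint

/-- The convention for w = 0 is automatic, as the numerator vanishes there. Almost everywhere on {w
≠ 0} the denominator equals `h_{φ,w}(φ x)`, which is finite and nonzero, so `toReal` loses nothing.
-/
theorem corollary7 {X : Type*} [MeasurableSpace X] (μ : Measure X) [SigmaFinite μ]
    (φ : X → X) (hφ : Measurable φ) (w : X → ℂ) (hw : Measurable w)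
    -- `C_φ` and `C_{φ,w}` are well-defined
    (hac₁ : weightImage μ φ 1 ≪ μ) (hac : weightImage μ φ w ≪ μ)
    -- `C_φ` and `C_{φ,w}` are densely defined
    (hd₁ : Dense ((wcompOp μ hφ measurable_one hac₁).domain : Set (Lp ℂ 2 μ)))
    (hd : Dense ((wcompOp μ hφ hw hac).domain : Set (Lp ℂ 2 μ))) :
    (∀ f : Lp ℂ 2 μ, f ∈ (reciprocal (wcompOp μ hφ hw hac).adjoint).domain ↔
      MemLp (fun x => w x * f (φ x) /
        ((hDeriv μ φ 1 (φ x) * wcondExp μ φ 1 (fun y => ‖w y‖ₑ ^ 2) x).toReal : ℂ)) 2 μ) ∧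
    (∀ f : (reciprocal (wcompOp μ hφ hw hac).adjoint).domain,
      (reciprocal (wcompOp μ hφ hw hac).adjoint f : X → ℂ) =ᵐ[μ]
        fun x => w x * (f : Lp ℂ 2 μ) (φ x) /
          ((hDeriv μ φ 1 (φ x) * wcondExp μ φ 1 (fun y => ‖w y‖ₑ ^ 2) x).toReal : ℂ)) := by
  have hprod := hDeriv_comp_eq_mul_wcondExp hφ hac₁ hac
    (hDeriv_lt_top hφ measurable_one hac₁ hd₁)
  have hcongr : ∀ f : Lp ℂ 2 μ,
      (fun x => w x * f (φ x) / ((hDeriv μ φ w (φ x)).toReal : ℂ)) =ᵐ[μ]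
        fun x => w x * f (φ x) /
          ((hDeriv μ φ 1 (φ x) * wcondExp μ φ 1 (fun y => ‖w y‖ₑ ^ 2) x).toReal : ℂ) := by
    intro f
    filter_upwards [hprod] with x hx
    rw [hx]
  have hval : ∀ f : (reciprocal (wcompOp μ hφ hw hac).adjoint).domain,
      (reciprocal (wcompOp μ hφ hw hac).adjoint f : X → ℂ) =ᵐ[μ]
        fun x => w x * (f : Lp ℂ 2 μ) (φ x) /
          ((hDeriv μ φ 1 (φ x) * wcondExp μ φ 1 (fun y => ‖w y‖ₑ ^ 2) x).toReal : ℂ) :=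
    fun f => ((mem_graph_reciprocal_adjoint_wcompOp_iff hd).1
      (LinearPMap.mem_graph _ f)).trans (hcongr f)
  refine ⟨fun f => ⟨fun hf => (Lp.memLp _).ae_eq (hval ⟨f, hf⟩), fun hf => ?_⟩, hval⟩
  exact LinearPMap.mem_domain_of_mem_graph ((mem_graph_reciprocal_adjoint_wcompOp_iff hd).2
    (hf.coeFn_toLp.trans (hcongr f).symm))
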